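/- Let $a<b$ and $c<d$ be real numbers. Let $\varphi_1,\dots,\varphi_n$ be an orthonormal system in the complex Hilbert space $L_2[a,b]$, let $\psi_1,\dots,\psi_m$ be an orthonormal system in the complex Hilbert space $L_2[c,d]$, and let $h_1,\dots,h_n$ and $p_1,\dots,p_m$ be essentially bounded measurable real functions on $[c,d]$ and on $[a,b]$, respectively (Lebesgue measure throughout). On the complex Hilbert space $L_2([a,b]\times[c,d])$ consider the bounded self-adjoint partial integral operators $$(T_1f)(x,y)=\int_a^b\sum_{k=1}^n\varphi_k(x)\overline{\varphi_k(s)}\,h_k(y)\,f(s,y)\,ds,\qquad (T_2f)(x,y)=\int_c^d\sum_{j=1}^m p_j(x)\,\psi_j(y)\overline{\psi_j(t)}\,f(x,t)\,dt,$$ and $T=T_1+T_2$. Let $E$ be the identity operator, and let $\sigma(A)$ and $\rho(A)=\mathbb{C}\setminus\sigma(A)$ denote the spectrum and the resolvent set of a bounded operator $A$. For a measurable real function $g$ on an interval $\Omega$, let $\mathrm{Essran}(g)$ be the set of all $\lambda\in\mathbb{R}$ such that $\{\xi\in\Omega:\ \lambda-\varepsilon<g(\xi)<\lambda+\varepsilon\}$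 has positive Lebesgue measure for every $\varepsilon>0$. For $\tau\in\mathbb{C}\setminus\{0\}$ with $\tau^{-1}\in\rho(T_1)\cap\rho(T_2)$ put $$(S_1(\tau)f)(x,y)=\sum_{k=1}^n\frac{h_k(y)}{1-\tau h_k(y)}\,\varphi_k(x)\int_a^b\overline{\varphi_k(s)}f(s,y)\,ds,\qquad W_1(\tau)=(E-\tau T_2)^{-1}S_1(\tau)T_2 .$$ The operator $W_1(\tau)$ has finite rank; let $\Delta_1(\tau)$ be the Fredholm determinant of $E-\tau^2W_1(\tau)$, where the Fredholm determinant of $E-A$ for a finite-rank operator $A$ is the determinant of the restriction of $E-A$ to the range of $A$. Let $$\mathcal{D}(T)=\{\tau\in\mathbb{C}\setminus\{0\}:\ \tau^{-1}\in\rho(T_1)\cap\rho(T_2),\ \Delta_1(\tau)=0\},\qquad \mathcal{D}_0(T)=\{1/\tau:\ \tau\in\mathcal{D}(T)\}.$$ Then $$\sigma(T_1+T_2)=\{0\}\cup\Big(\bigcup_{i=1}^n\mathrm{Essran}(h_i)\Big)\cup\Big(\bigcup_{j=1}^m\mathrm{Essran}(p_j)\Big)\cup\mathcal{D}_0(T).$$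 -/

import Mathlib

open MeasureTheory Set
open scoped ENNReal ComplexConjugate
noncomputable section
namespace PartialIntegral
variable {X Y : Type*} [MeasurableSpace X] [MeasurableSpace Y]

/-- The partial integral operator `(T f)(x, y) = ∫ k(x, s, y) f(s, y) dμ(s)` on `L²(μ × ν)`: the
bounded operator given by this formula (unique, since an element of `L²` is determined by its values
almost everywhere). When the formula does not define a bounded operator the value is `0`; this does
not happen for the degenerate kernels below, see `pio₁_spec`. -/
def pio₁ (μ : Measure X) (ν : Measure Y) (k : X → X → Y → ℂ) :
    Lp ℂ 2 (μ.prod ν) →L[ℂ] Lp ℂ 2 (μ.prod ν) :=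
  open scoped Classical in
  if hk : ∃ T : Lp ℂ 2 (μ.prod ν) →L[ℂ] Lp ℂ 2 (μ.prod ν), ∀ f : Lp ℂ 2 (μ.prod ν),
      T f =ᵐ[μ.prod ν] fun z => ∫ s, k z.1 s z.2 * f (s, z.2) ∂μ
  then hk.choose else 0

/-- The partial integral operator `(T f)(x, y) = ∫ k(x, t, y) f(x, t) dν(t)` on `L²(μ × ν)`, with
the same convention as `pio₁`, see `pio₂_spec`. -/
def pio₂ (μ : Measure X) (ν : Measure Y) (k : X → Y → Y → ℂ) :
    Lp ℂ 2 (μ.prod ν) →L[ℂ] Lp ℂ 2 (μ.prod ν) :=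
  open scoped Classical in
  if hk : ∃ T : Lp ℂ 2 (μ.prod ν) →L[ℂ] Lp ℂ 2 (μ.prod ν), ∀ f : Lp ℂ 2 (μ.prod ν),
      T f =ᵐ[μ.prod ν] fun z => ∫ t, k z.1 t z.2 * f (z.1, t) ∂ν
  then hk.choose else 0

/-- The degenerate kernel `∑ₖ φₖ(x) conj(φₖ(s)) gₖ(y)`. -/
def kernel₁ {n : ℕ} (φ : Fin n → X → ℂ) (g : Fin n → Y → ℂ) (x s : X) (y : Y) : ℂ :=
  ∑ k, φ k x * conj (φ k s) * g k y

/-- The degenerate kernel `∑ⱼ pⱼ(x) ψⱼ(y) conj(ψⱼ(t))`. -/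
def kernel₂ {m : ℕ} (ψ : Fin m → Y → ℂ) (p : Fin m → X → ℂ) (x : X) (t y : Y) : ℂ :=
  ∑ j, p j x * ψ j y * conj (ψ j t)

lemma eLpNorm_two_sq {Z : Type*} [MeasurableSpace Z] (ρ : Measure Z) (f : Z → ℂ) :
    eLpNorm f 2 ρ = (∫⁻ z, ‖f z‖ₑ ^ (2 : ℝ) ∂ρ) ^ (1 / 2 : ℝ) := by
  rw [eLpNorm_eq_lintegral_rpow_enorm_toReal (by norm_num) (by norm_num)]; simp

variable {μ : Measure X} {ν : Measure Y} [SFinite μ] [SFinite ν]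

/-- slices of a square integrable function are square integrable -/
lemma ae_slice {f : X × Y → ℂ} (hf : MemLp f 2 (μ.prod ν)) :
    ∀ᵐ y ∂ν, MemLp (fun s => f (s, y)) 2 μ := by
  have h1 : MemLp (fun w : Y × X => f w.swap) 2 (ν.prod μ) :=
    hf.comp_measurePreserving Measure.measurePreserving_swap
  have h2 := h1.1.prodMk_left
  have h3 : ∫⁻ y, ∫⁻ s, ‖f (s, y)‖ₑ ^ (2 : ℝ) ∂μ ∂ν ≠ ∞ := by
    have h4 := h1.2
    rw [eLpNorm_two_sq, ENNReal.rpow_lt_top_iff_of_pos (by norm_num),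
      lintegral_prod _ (h1.1.enorm.pow_const _)] at h4
    exact h4.ne
  have h5 := ae_lt_top' (h1.1.enorm.pow_const (2 : ℝ)).lintegral_prod_right' h3
  filter_upwards [h2, h5] with y hy hy'
  refine ⟨hy, ?_⟩
  rw [eLpNorm_two_sq, ENNReal.rpow_lt_top_iff_of_pos (by norm_num)]
  exact hy'

lemma ae_slice_integrable {v : X → ℂ} (hv : MemLp v 2 μ) {f : X × Y → ℂ}
    (hf : MemLp f 2 (μ.prod ν)) :
    ∀ᵐ y ∂ν, Integrable (fun s => conj (v s) * f (s, y)) μ := by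
  filter_upwards [ae_slice hf] with y hy
  exact MemLp.integrable_mul (p := 2) (q := 2) hv.star hy

lemma memLp_slice {v : X → ℂ} (hv : MemLp v 2 μ) {f : X × Y → ℂ}
    (hf : MemLp f 2 (μ.prod ν)) :
    AEStronglyMeasurable (fun y => ∫ s, conj (v s) * f (s, y) ∂μ) ν ∧
    eLpNorm (fun y => ∫ s, conj (v s) * f (s, y) ∂μ) 2 ν
      ≤ eLpNorm v 2 μ * eLpNorm f 2 (μ.prod ν) := by
  have hs : MemLp (fun w : Y × X => f w.swap) 2 (ν.prod μ) :=
    hf.comp_measurePreserving Measure.measurePreserving_swap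
  have hm : AEStronglyMeasurable (fun w : Y × X => conj (v w.2) * f (w.2, w.1)) (ν.prod μ) :=
    (hv.star.1.comp_snd).mul hs.1
  refine ⟨hm.integral_prod_right', ?_⟩
  have hb : ∀ᵐ y ∂ν, ‖∫ s, conj (v s) * f (s, y) ∂μ‖ₑ ^ (2 : ℝ) ≤
      eLpNorm v 2 μ ^ (2 : ℝ) * ∫⁻ s, ‖f (s, y)‖ₑ ^ (2 : ℝ) ∂μ := by
    filter_upwards [ae_slice hf] with y hy
    have h1 : ‖∫ s, conj (v s) * f (s, y) ∂μ‖ₑ ≤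
        (∫⁻ s, ‖v s‖ₑ ^ (2 : ℝ) ∂μ) ^ (1 / 2 : ℝ) *
          (∫⁻ s, ‖f (s, y)‖ₑ ^ (2 : ℝ) ∂μ) ^ (1 / 2 : ℝ) := by
      refine (enorm_integral_le_lintegral_enorm _).trans ?_
      have := ENNReal.lintegral_mul_le_Lp_mul_Lq μ Real.HolderConjugate.two_two
        hv.1.enorm hy.1.enorm
      simpa [enorm_mul] using this
    calc _ ≤ _ := ENNReal.rpow_le_rpow h1 (by norm_num : (0 : ℝ) ≤ 2)
      _ = _ := by
        rw [eLpNorm_two_sq, ENNReal.mul_rpow_of_nonneg _ _ (by norm_num), ← ENNReal.rpow_mul,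
          ← ENNReal.rpow_mul]
        norm_num
  have hi : ∫⁻ y, ‖∫ s, conj (v s) * f (s, y) ∂μ‖ₑ ^ (2 : ℝ) ∂ν ≤
      eLpNorm v 2 μ ^ (2 : ℝ) * eLpNorm f 2 (μ.prod ν) ^ (2 : ℝ) := by
    refine (lintegral_mono_ae hb).trans ?_
    have hms : AEMeasurable (fun y => ∫⁻ s, ‖f (s, y)‖ₑ ^ (2 : ℝ) ∂μ) ν :=
      (hs.1.enorm.pow_const (2 : ℝ)).lintegral_prod_right'
    rw [lintegral_const_mul'' _ hms]
    gcongr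
    rw [eLpNorm_two_sq _ f, ← ENNReal.rpow_mul, lintegral_prod_symm _ (hf.1.enorm.pow_const _)]
    norm_num
  rw [eLpNorm_two_sq]
  calc _ ≤ _ := ENNReal.rpow_le_rpow hi (by norm_num : (0 : ℝ) ≤ 1 / 2)
    _ = _ := by
      rw [ENNReal.mul_rpow_of_nonneg _ _ (by norm_num), ← ENNReal.rpow_mul, ← ENNReal.rpow_mul]
      norm_num

lemma tensor_norm {u : X → ℂ} (hu : MemLp u 2 μ) {w : Y → ℂ} (hw : AEStronglyMeasurable w ν) :
    AEStronglyMeasurable (fun z : X × Y => u z.1 * w z.2) (μ.prod ν) ∧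
    eLpNorm (fun z : X × Y => u z.1 * w z.2) 2 (μ.prod ν) = eLpNorm u 2 μ * eLpNorm w 2 ν := by
  refine ⟨hu.1.comp_fst.mul hw.comp_snd, ?_⟩
  rw [eLpNorm_two_sq, eLpNorm_two_sq, eLpNorm_two_sq, ← ENNReal.mul_rpow_of_nonneg _ _ (by norm_num),
    ← lintegral_prod_mul (hu.1.enorm.pow_const _) (hw.enorm.pow_const _)]
  congr 1
  refine lintegral_congr fun z => ?_
  rw [enorm_mul, ENNReal.mul_rpow_of_nonneg _ _ (by norm_num)]

lemma exists_single {u v : X → ℂ} {g : Y → ℂ} (hu : MemLp u 2 μ) (hv : MemLp v 2 μ)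
    (hg : MemLp g ∞ ν) :
    ∃ T : Lp ℂ 2 (μ.prod ν) →L[ℂ] Lp ℂ 2 (μ.prod ν), ∀ f : Lp ℂ 2 (μ.prod ν),
      T f =ᵐ[μ.prod ν] fun z => u z.1 * (g z.2 * ∫ s, conj (v s) * f (s, z.2) ∂μ) := by
  have key : ∀ f : Lp ℂ 2 (μ.prod ν),
      AEStronglyMeasurable (fun z : X × Y => u z.1 * (g z.2 * ∫ s, conj (v s) * f (s, z.2) ∂μ))
        (μ.prod ν) ∧
      eLpNorm (fun z : X × Y => u z.1 * (g z.2 * ∫ s, conj (v s) * f (s, z.2) ∂μ)) 2 (μ.prod ν) ≤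
        eLpNorm u 2 μ * (eLpNorm g ∞ ν * eLpNorm v 2 μ) * eLpNorm f 2 (μ.prod ν) := by
    intro f
    obtain ⟨h1, h2⟩ := memLp_slice hv (Lp.memLp f)
    obtain ⟨h3, h4⟩ := tensor_norm (μ := μ) hu (hg.1.mul h1)
    refine ⟨h3, ?_⟩
    refine h4.le.trans ?_
    rw [mul_assoc]
    gcongr
    refine (eLpNorm_smul_le_eLpNorm_top_mul_eLpNorm (𝕜 := ℂ) 2 h1 g).trans ?_
    rw [mul_assoc]
    gcongr
  have hC : eLpNorm u 2 μ * (eLpNorm g ∞ ν * eLpNorm v 2 μ) ≠ ∞ :=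
    ENNReal.mul_ne_top hu.2.ne (ENNReal.mul_ne_top hg.2.ne hv.2.ne)
  have hmem : ∀ f : Lp ℂ 2 (μ.prod ν),
      MemLp (fun z : X × Y => u z.1 * (g z.2 * ∫ s, conj (v s) * f (s, z.2) ∂μ)) 2 (μ.prod ν) :=
    fun f => ⟨(key f).1, (key f).2.trans_lt (ENNReal.mul_lt_top hC.lt_top (Lp.memLp f).2)⟩
  have slice : ∀ {F G : X × Y → ℂ}, F =ᵐ[μ.prod ν] G →
      ∀ᵐ z ∂(μ.prod ν), ∀ᵐ s ∂μ, F (s, z.2) = G (s, z.2) := by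
    intro F G hFG
    have h1 : ∀ᵐ w ∂(ν.prod μ), F w.swap = G w.swap :=
      Measure.measurePreserving_swap.quasiMeasurePreserving.ae hFG
    exact Measure.quasiMeasurePreserving_snd.ae (Measure.ae_ae_of_ae_prod h1)
  let L : Lp ℂ 2 (μ.prod ν) →ₗ[ℂ] Lp ℂ 2 (μ.prod ν) :=
    { toFun := fun f => (hmem f).toLp _
      map_add' := by
        intro f f'
        rw [← MemLp.toLp_add]
        refine MemLp.toLp_congr _ _ ?_
        filter_upwards [slice (Lp.coeFn_add f f'),
          Measure.quasiMeasurePreserving_snd.ae (ae_slice_integrable hv (Lp.memLp f)),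
          Measure.quasiMeasurePreserving_snd.ae (ae_slice_integrable hv (Lp.memLp f'))]
          with z hz h1 h2
        have : ∫ s, conj (v s) * (f + f') (s, z.2) ∂μ =
            ∫ s, (conj (v s) * f (s, z.2) + conj (v s) * f' (s, z.2)) ∂μ := by
          refine integral_congr_ae ?_
          filter_upwards [hz] with s hs
          simp only [hs, Pi.add_apply, mul_add]
        simp only [this, integral_add h1 h2, Pi.add_apply]
        ring
      map_smul' := by
        intro c f
        rw [RingHom.id_apply, ← MemLp.toLp_const_smul]
        refine MemLp.toLp_congr _ _ ?_
        filter_upwards [slice (Lp.coeFn_smul c f)] with z hz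
        have : ∫ s, conj (v s) * (c • f) (s, z.2) ∂μ =
            ∫ s, c * (conj (v s) * f (s, z.2)) ∂μ := by
          refine integral_congr_ae ?_
          filter_upwards [hz] with s hs
          simp only [hs, Pi.smul_apply, smul_eq_mul]
          ring
        simp only [this, integral_const_mul, Pi.smul_apply, smul_eq_mul]
        ring }
  refine ⟨L.mkContinuous (eLpNorm u 2 μ * (eLpNorm g ∞ ν * eLpNorm v 2 μ)).toReal ?_,
    fun f => (hmem f).coeFn_toLp⟩
  intro f
  change ‖(hmem f).toLp _‖ ≤ _
  rw [Lp.norm_toLp, Lp.norm_def, ← ENNReal.toReal_mul]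
  exact ENNReal.toReal_mono (ENNReal.mul_ne_top hC (Lp.memLp f).2.ne) (key f).2

lemma exists_pio₁_sum {n : ℕ} {φ : Fin n → X → ℂ} {g : Fin n → Y → ℂ}
    (hφ : ∀ k, MemLp (φ k) 2 μ) (hg : ∀ k, MemLp (g k) ∞ ν) :
    ∃ T : Fin n → Lp ℂ 2 (μ.prod ν) →L[ℂ] Lp ℂ 2 (μ.prod ν),
      (∀ k f, T k f =ᵐ[μ.prod ν]
        fun z => φ k z.1 * (g k z.2 * ∫ s, conj (φ k s) * f (s, z.2) ∂μ)) ∧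
      ∀ f, (∑ k, T k) f =ᵐ[μ.prod ν]
        fun z => ∫ s, kernel₁ φ g z.1 s z.2 * f (s, z.2) ∂μ := by
  choose T hT using fun k => exists_single (hφ k) (hφ k) (hg k)
  refine ⟨T, hT, fun f => ?_⟩
  rw [sum_apply]
  filter_upwards [Lp.coeFn_fun_finsetSum Finset.univ (fun k => T k f),
    ae_all_iff.2 fun k => hT k f,
    ae_all_iff.2 fun k => Measure.quasiMeasurePreserving_snd.ae
      (ae_slice_integrable (hφ k) (Lp.memLp f))] with z h1 h2 h3
  rw [h1]
  simp only [h2, kernel₁, Finset.sum_mul]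
  rw [integral_finsetSum]
  · refine Finset.sum_congr rfl fun k _ => ?_
    rw [← integral_const_mul, ← integral_const_mul]
    congr 1; ext s; ring
  · intro k _
    refine ((h3 k).const_mul (φ k z.1 * g k z.2)).congr (.of_forall fun s => ?_)
    simp only; ring

lemma exists_pio₂_sum {m : ℕ} {ψ : Fin m → Y → ℂ} {p : Fin m → X → ℂ}
    (hψ : ∀ j, MemLp (ψ j) 2 ν) (hp : ∀ j, MemLp (p j) ∞ μ) :
    ∃ T : Fin m → Lp ℂ 2 (μ.prod ν) →L[ℂ] Lp ℂ 2 (μ.prod ν),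
      (∀ j f, T j f =ᵐ[μ.prod ν]
        fun z => ψ j z.2 * (p j z.1 * ∫ t, conj (ψ j t) * f (z.1, t) ∂ν)) ∧
      ∀ f, (∑ j, T j) f =ᵐ[μ.prod ν]
        fun z => ∫ t, kernel₂ ψ p z.1 t z.2 * f (z.1, t) ∂ν := by
  obtain ⟨T, hT, hS⟩ := exists_pio₁_sum (μ := ν) (ν := μ) hψ hp
  have sw : MeasurePreserving Prod.swap (μ.prod ν) (ν.prod μ) := Measure.measurePreserving_swap
  have sw' : MeasurePreserving Prod.swap (ν.prod μ) (μ.prod ν) := Measure.measurePreserving_swap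
  let U : Lp ℂ 2 (ν.prod μ) →L[ℂ] Lp ℂ 2 (μ.prod ν) :=
    (Lp.compMeasurePreservingₗᵢ ℂ Prod.swap sw).toContinuousLinearMap
  let V : Lp ℂ 2 (μ.prod ν) →L[ℂ] Lp ℂ 2 (ν.prod μ) :=
    (Lp.compMeasurePreservingₗᵢ ℂ Prod.swap sw').toContinuousLinearMap
  have hU : ∀ f, U f =ᵐ[μ.prod ν] fun z => f z.swap :=
    fun f => Lp.coeFn_compMeasurePreserving f sw
  have hV : ∀ f, ∀ᵐ z ∂(μ.prod ν), ∀ᵐ t ∂ν, V f (t, z.1) = f (z.1, t) := by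
    intro f
    have h1 : ∀ᵐ w ∂(ν.prod μ), V f w = f w.swap := Lp.coeFn_compMeasurePreserving f sw'
    exact Measure.quasiMeasurePreserving_fst.ae
      (Measure.ae_ae_of_ae_prod (sw.quasiMeasurePreserving.ae h1))
  refine ⟨fun j => U ∘L T j ∘L V, fun j f => ?_, fun f => ?_⟩
  · filter_upwards [hU (T j (V f)), sw.quasiMeasurePreserving.ae (hT j (V f)), hV f] with z h1 h2 h3
    change U (T j (V f)) z = _
    rw [h1, h2]
    simp only [Prod.fst_swap, Prod.snd_swap]
    congr 2
    refine integral_congr_ae ?_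
    filter_upwards [h3] with t ht
    rw [ht]
  · have h0 : (∑ j, U ∘L T j ∘L V) f = U ((∑ j, T j) (V f)) := by
      simp [sum_apply]
    rw [h0]
    filter_upwards [hU ((∑ j, T j) (V f)), sw.quasiMeasurePreserving.ae (hS (V f)), hV f]
      with z h1 h2 h3
    rw [h1, h2]
    refine integral_congr_ae ?_
    filter_upwards [h3] with t ht
    simp only [Prod.fst_swap, Prod.snd_swap, ht, kernel₁, kernel₂]
    congr 1
    refine Finset.sum_congr rfl fun j _ => ?_
    ring

/-- A degenerate kernel with essentially bounded symbols does define a bounded operator. -/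
theorem pio₁_spec {n : ℕ} {φ : Fin n → X → ℂ} {g : Fin n → Y → ℂ} (hφ : ∀ k, MemLp (φ k) 2 μ)
    (hg : ∀ k, MemLp (g k) ∞ ν) (f : Lp ℂ 2 (μ.prod ν)) :
    pio₁ μ ν (kernel₁ φ g) f =ᵐ[μ.prod ν]
      fun z => ∫ s, kernel₁ φ g z.1 s z.2 * f (s, z.2) ∂μ := by
  obtain ⟨T, -, hT⟩ := exists_pio₁_sum hφ hg
  have h : ∃ T : Lp ℂ 2 (μ.prod ν) →L[ℂ] Lp ℂ 2 (μ.prod ν), ∀ f : Lp ℂ 2 (μ.prod ν),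
      T f =ᵐ[μ.prod ν] fun z => ∫ s, kernel₁ φ g z.1 s z.2 * f (s, z.2) ∂μ := ⟨_, hT⟩
  unfold pio₁
  rw [dif_pos h]
  exact h.choose_spec f

theorem pio₂_spec {m : ℕ} {ψ : Fin m → Y → ℂ} {p : Fin m → X → ℂ} (hψ : ∀ j, MemLp (ψ j) 2 ν)
    (hp : ∀ j, MemLp (p j) ∞ μ) (f : Lp ℂ 2 (μ.prod ν)) :
    pio₂ μ ν (kernel₂ ψ p) f =ᵐ[μ.prod ν]
      fun z => ∫ t, kernel₂ ψ p z.1 t z.2 * f (z.1, t) ∂ν := by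
  obtain ⟨T, -, hT⟩ := exists_pio₂_sum hψ hp
  have h : ∃ T : Lp ℂ 2 (μ.prod ν) →L[ℂ] Lp ℂ 2 (μ.prod ν), ∀ f : Lp ℂ 2 (μ.prod ν),
      T f =ᵐ[μ.prod ν] fun z => ∫ t, kernel₂ ψ p z.1 t z.2 * f (z.1, t) ∂ν := ⟨_, hT⟩
  unfold pio₂
  rw [dif_pos h]
  exact h.choose_spec f

/-- The product of the two kinds of operators has finite rank. -/
theorem finiteDimensional_range_pio₁_comp_pio₂ {n m : ℕ} {φ : Fin n → X → ℂ} {g : Fin n → Y → ℂ}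
    {ψ : Fin m → Y → ℂ} {p : Fin m → X → ℂ}
    (hφ : ∀ k, MemLp (φ k) 2 μ) (hg : ∀ k, MemLp (g k) ∞ ν)
    (hψ : ∀ j, MemLp (ψ j) 2 ν) (hp : ∀ j, MemLp (p j) ∞ μ) :
    FiniteDimensional ℂ
      (LinearMap.range (pio₁ μ ν (kernel₁ φ g) ∘L pio₂ μ ν (kernel₂ ψ p)).toLinearMap) := by
  obtain ⟨A, hA, hA'⟩ := exists_pio₁_sum (ν := ν) hφ hg
  obtain ⟨B, hB, hB'⟩ := exists_pio₂_sum (μ := μ) hψ hp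
  have eA : pio₁ μ ν (kernel₁ φ g) = ∑ k, A k := by
    ext1 f
    exact Lp.ext ((pio₁_spec hφ hg f).trans (hA' f).symm)
  have eB : pio₂ μ ν (kernel₂ ψ p) = ∑ j, B j := by
    ext1 f
    exact Lp.ext ((pio₂_spec hψ hp f).trans (hB' f).symm)
  have hmem : ∀ i : Fin n × Fin m,
      MemLp (fun z : X × Y => φ i.1 z.1 * (g i.1 z.2 * ψ i.2 z.2)) 2 (μ.prod ν) := by
    intro i
    have hw : MemLp (fun y => g i.1 y * ψ i.2 y) 2 ν := (hψ i.2).mul (hg i.1)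
    obtain ⟨h1, h2⟩ := tensor_norm (μ := μ) (hφ i.1) hw.1
    exact ⟨h1, h2.trans_lt (ENNReal.mul_lt_top (hφ i.1).2 hw.2)⟩
  let e : Fin n × Fin m → Lp ℂ 2 (μ.prod ν) := fun i => (hmem i).toLp _
  have hAB : ∀ k j f, A k (B j f) ∈ Submodule.span ℂ (Set.range e) := by
    intro k j f
    have : A k (B j f) =
        (∫ s, conj (φ k s) * (p j s * ∫ t, conj (ψ j t) * f (s, t) ∂ν) ∂μ) • e (k, j) := by
      refine Lp.ext ?_
      have sl : ∀ᵐ z ∂(μ.prod ν), ∀ᵐ s ∂μ, B j f (s, z.2) =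
          ψ j z.2 * (p j s * ∫ t, conj (ψ j t) * f (s, t) ∂ν) := by
        have h1 := (Measure.measurePreserving_swap (μ := ν) (ν := μ)).quasiMeasurePreserving.ae
          (hB j f)
        exact Measure.quasiMeasurePreserving_snd.ae (Measure.ae_ae_of_ae_prod h1)
      filter_upwards [hA k (B j f), sl, (hmem (k, j)).coeFn_toLp, Lp.coeFn_smul
        (∫ s, conj (φ k s) * (p j s * ∫ t, conj (ψ j t) * f (s, t) ∂ν) ∂μ) (e (k, j))]
        with z h1 h2 h3 h4
      rw [h1, h4, Pi.smul_apply, h3, smul_eq_mul]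
      have : ∫ s, conj (φ k s) * B j f (s, z.2) ∂μ =
          ∫ s, conj (φ k s) * (p j s * ∫ t, conj (ψ j t) * f (s, t) ∂ν) * ψ j z.2 ∂μ := by
        refine integral_congr_ae ?_
        filter_upwards [h2] with s hs
        rw [hs]; ring
      rw [this, integral_mul_const]
      ring
    rw [this]
    exact Submodule.smul_mem _ _ (Submodule.subset_span ⟨_, rfl⟩)
  have : FiniteDimensional ℂ (Submodule.span ℂ (Set.range e)) :=
    FiniteDimensional.span_of_finite ℂ (Set.finite_range e)
  refine Submodule.finiteDimensional_of_le (S₂ := Submodule.span ℂ (Set.range e)) ?_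
  rintro _ ⟨f, rfl⟩
  simp only [eA, eB, ContinuousLinearMap.coe_coe, ContinuousLinearMap.comp_apply, sum_apply, map_sum]
  exact Submodule.sum_mem _ fun k _ => Submodule.sum_mem _ fun j _ => hAB _ _ _

/-- The Fredholm determinant `det(E - A)` of an operator `A` of finite rank: the determinant of the
restriction of `E - A` to the finite-dimensional invariant subspace `range A`. -/
def fredholmDet {V : Type*} [AddCommGroup V] [Module ℂ V] (A : V →ₗ[ℂ] V) : ℂ :=
  LinearMap.det ((LinearMap.id - A).restrict
    (p := LinearMap.range A) (q := LinearMap.range A)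
    fun v hv => Submodule.sub_mem _ hv (LinearMap.mem_range_self A v))

/-- Lebesgue measure on `[a, b]`. -/
abbrev leb (a b : ℝ) : Measure ℝ := volume.restrict (Icc a b)

/-- The essential values of a real function `f` on `Ω ⊆ ℝ`. -/
def Essran (Ω : Set ℝ) (f : ℝ → ℝ) : Set ℝ :=
  {l | ∀ ε > 0, 0 < volume {ξ | ξ ∈ Ω ∧ l - ε < f ξ ∧ f ξ < l + ε}}

/-- The complex Hilbert space `L₂([a, b] × [c, d])`. -/
abbrev L2Rect (a b c d : ℝ) : Type := Lp ℂ 2 ((leb a b).prod (leb c d))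

section operators

variable {a b c d : ℝ} {n m : ℕ}
  (φ : Fin n → Lp ℂ 2 (leb a b)) (h : Fin n → ℝ → ℝ)
  (ψ : Fin m → Lp ℂ 2 (leb c d)) (p : Fin m → ℝ → ℝ)

/-- `(T₁ f)(x, y) = ∫ₐᵇ (∑ₖ φₖ(x) conj(φₖ(s)) hₖ(y)) f(s, y) ds` on `L₂([a, b] × [c, d])`. -/
def T₁ (c d : ℝ) : L2Rect a b c d →L[ℂ] L2Rect a b c d :=
  pio₁ (leb a b) (leb c d) (kernel₁ (fun k => ⇑(φ k)) fun k y => (h k y : ℂ))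

/-- `(T₂ f)(x, y) = ∫_c^d (∑ⱼ pⱼ(x) ψⱼ(y) conj(ψⱼ(t))) f(x, t) dt` on `L₂([a, b] × [c, d])`. -/
def T₂ (a b : ℝ) : L2Rect a b c d →L[ℂ] L2Rect a b c d :=
  pio₂ (leb a b) (leb c d) (kernel₂ (fun j => ⇑(ψ j)) fun j x => (p j x : ℂ))

/-- `S₁(τ) = ∑ₖ (hₖ(y) / (1 - τ hₖ(y))) Pₖ`, with `(Pₖ f)(x, y) = φₖ(x) ∫ conj(φₖ(s)) f(s, y) ds`. -/
def S₁ (c d : ℝ) (τ : ℂ) : L2Rect a b c d →L[ℂ] L2Rect a b c d :=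
  pio₁ (leb a b) (leb c d)
    (kernel₁ (fun k => ⇑(φ k)) fun k y => (h k y : ℂ) / (1 - τ * (h k y : ℂ)))

/-- `W₁(τ) = (E - τ T₂)⁻¹ S₁(τ) T₂`, an operator of finite rank
(compare `finiteDimensional_range_pio₁_comp_pio₂`). -/
def W₁ (τ : ℂ) : L2Rect a b c d →L[ℂ] L2Rect a b c d :=
  Ring.inverse (1 - τ • T₂ ψ p a b) * S₁ φ h c d τ * T₂ ψ p a b

/-- `Δ₁(τ)`, the Fredholm determinant of `E - τ² W₁(τ)`. -/
def Δ₁ (τ : ℂ) : ℂ := fredholmDet (τ ^ 2 • W₁ φ h ψ p τ).toLinearMap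

/-- The set `𝒟(T)` of all `τ ≠ 0` with `τ⁻¹ ∈ ρ(T₁) ∩ ρ(T₂)` and `Δ₁(τ) = 0`. -/
def setD : Set ℂ :=
  {τ | τ ≠ 0 ∧ τ⁻¹ ∈ resolventSet ℂ (T₁ φ h c d) ∩ resolventSet ℂ (T₂ ψ p a b) ∧
    Δ₁ φ h ψ p τ = 0}

/-- The set `𝒟₀(T) = {1 / τ : τ ∈ 𝒟(T)}`. -/
def setD₀ : Set ℂ := {ξ | ∃ τ ∈ setD φ h ψ p, ξ = 1 / τ}

end operators

end PartialIntegral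

end

/-! ### Determinants, factorization and approximate eigenvalues -/

namespace PartialIntegral

/-! Orthonormality of `φ` makes symbols multiply: composing two operators with kernels `kernel₁ φ g`
and `kernel₁ φ g'` gives the one with symbols `g k * g' k`. If `l ≠ 0` avoids all the essential
ranges and `τ = l⁻¹`, every `1 - τ hₖ` and `1 - τ pⱼ` is bounded away from zero, so `E - τT₁` and `E
- τT₂` are invertible and `S₁(τ) = (E - τT₁)⁻¹T₁`. Then `E - τ(T₁ + T₂) = (E - τT₁)(E - τT₂)(E -
τ²W₁(τ))` (`one_sub_smul_add_eq`). Since `S₁(τ)T₂` has finite rank, so has `W₁(τ)`, and the last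
factor is invertible exactly when `Δ₁(τ) ≠ 0` (`fredholmDet_ne_zero_iff`).

The remaining points all belong to the spectrum. For `l` in the essential range of `hᵢ`, the
functions `φᵢ ⊗ w`, with `w` orthogonal to every `ψⱼ` and supported where `hᵢ` is near `l`, are
annihilated by `T₂` and are approximate eigenvectors of `T₁` (`mem_spectrum_of_concentrated`). Such
`w` exist because a set of positive measure carries an infinite-dimensional space of square
integrable functions (`exists_orthogonal_supported`). The `pⱼ` follow by exchanging the variables,
and `0` is an eigenvalue with eigenvector `u ⊗ w`, where `u ⊥ φₖ` and `w ⊥ ψⱼ`. -/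

/-- Modulo `range A` the map `1 - A` is the identity, so bijectivity is decided on `range A`. A
kernel vector satisfies `v = A v` and lies there; if `w` in the range solves `(1 - A) w = A v`, then
`v + w` is a preimage of `v`. -/
theorem fredholmDet_ne_zero_iff {V : Type*} [AddCommGroup V] [Module ℂ V] (A : V →ₗ[ℂ] V)
    [FiniteDimensional ℂ (LinearMap.range A)] :
    fredholmDet A ≠ 0 ↔ Function.Bijective (LinearMap.id - A : V →ₗ[ℂ] V) := by
  unfold fredholmDet
  set B := (LinearMap.id - A).restrict
    (p := LinearMap.range A) (q := LinearMap.range A)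
    fun v hv => Submodule.sub_mem _ hv (LinearMap.mem_range_self A v) with hB
  have hBv : ∀ v, (B v : V) = v - A v := fun v => rfl
  rw [← isUnit_iff_ne_zero, ← LinearMap.isUnit_iff_isUnit_det, Module.End.isUnit_iff]
  constructor
  · rintro ⟨hi, hs⟩
    refine ⟨(injective_iff_map_eq_zero _).2 fun v hv => ?_, fun v => ?_⟩
    · have hv' : v = A v := by simpa [sub_eq_zero] using hv
      have h0 : (⟨v, ⟨v, hv'.symm⟩⟩ : LinearMap.range A) = 0 :=
        (injective_iff_map_eq_zero B).1 hi _ (Subtype.ext hv)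
      exact congrArg Subtype.val h0
    · obtain ⟨w, hw⟩ := hs ⟨A v, v, rfl⟩
      have hw' : (w : V) - A w = A v := by rw [← hBv, hw]
      refine ⟨v + w, ?_⟩
      simp only [LinearMap.sub_apply, LinearMap.id_apply, map_add]
      rw [← hw']
      abel
  · rintro ⟨hi, -⟩
    have hBi : Function.Injective B := fun v w hvw =>
      Subtype.ext (hi (by simpa [hBv] using congrArg Subtype.val hvw))
    exact ⟨hBi, LinearMap.injective_iff_surjective.1 hBi⟩

/-- The factorization `1 - τ(a + b) = (1 - τa)(1 - τb)(1 - τ²(1 - τb)⁻¹ s b)` for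
`s = (1 - τa)⁻¹ a`. -/
theorem one_sub_smul_add_eq {R : Type*} [Ring R] [Algebra ℂ R] {a b s : R} {τ : ℂ}
    (hs : (1 - τ • a) * s = a) (hb : IsUnit (1 - τ • b)) :
    1 - τ • (a + b) =
      (1 - τ • a) * (1 - τ • b) * (1 - τ ^ 2 • (Ring.inverse (1 - τ • b) * s * b)) := by
  have h1 : (1 - τ • b) * (Ring.inverse (1 - τ • b) * s * b) = s * b := by
    rw [← mul_assoc, ← mul_assoc, Ring.mul_inverse_cancel _ hb, one_mul]
  -- Both sides equal `(1 - τa)(1 - τb) - τ²ab`: the last factor on the right removes the cross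
  -- term.
  rw [mul_sub, mul_one, mul_smul_comm, mul_assoc (1 - τ • a), h1, ← mul_assoc, hs]
  simp only [sub_mul, mul_sub, one_mul, mul_one, smul_mul_smul_comm, smul_add, pow_two]
  abel

theorem isUnit_one_sub_smul_iff {R : Type*} [Ring R] [Algebra ℂ R] (a : R) {τ : ℂ} (hτ : τ ≠ 0) :
    IsUnit (1 - τ • a) ↔ τ⁻¹ ∈ resolventSet ℂ a := by
  rw [spectrum.mem_resolventSet_iff]
  have h : algebraMap ℂ R τ⁻¹ - a = τ⁻¹ • (1 - τ • a) := by
    rw [smul_sub, smul_smul, inv_mul_cancel₀ hτ, one_smul, Algebra.algebraMap_eq_smul_one]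
  rw [h]
  exact (isUnit_smul_iff (Units.mk0 τ⁻¹ (inv_ne_zero hτ)) (1 - τ • a)).symm

/-- An approximate eigenvalue of a bounded operator lies in its spectrum. -/
theorem mem_spectrum_of_approx {H : Type*} [NormedAddCommGroup H] [NormedSpace ℂ H]
    (T : H →L[ℂ] H) (l : ℂ) (hT : ∀ ε > 0, ∃ f, f ≠ 0 ∧ ‖T f - l • f‖ ≤ ε * ‖f‖) :
    l ∈ spectrum ℂ T := by
  rintro ⟨u, hu⟩
  set R : H →L[ℂ] H := ↑u⁻¹
  have hR : ∀ f, R (l • f - T f) = f := fun f => by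
    have h1 : (R * u) f = f := by simp [R]
    rw [hu] at h1
    simpa [Algebra.algebraMap_eq_smul_one] using h1
  -- This `ε` makes `‖R‖ * ε < 1`, also when `‖R‖ = 0`.
  obtain ⟨f, hf, hle⟩ := hT (1 / (‖R‖ + 1)) (by positivity)
  have hf' : 0 < ‖f‖ := norm_pos_iff.2 hf
  have h2 : ‖f‖ ≤ ‖R‖ * (1 / (‖R‖ + 1) * ‖f‖) :=
    calc ‖f‖ = ‖R (l • f - T f)‖ := by rw [hR]
      _ ≤ ‖R‖ * ‖l • f - T f‖ := R.le_opNorm _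
      _ ≤ _ := by rw [norm_sub_rev]; gcongr
  have h3 : ‖R‖ * (1 / (‖R‖ + 1)) < 1 := by
    rw [mul_one_div, div_lt_one (by positivity)]; linarith
  nlinarith

/-! ### Fibrewise formulas for partial integral operators -/

variable {X Y : Type*} [MeasurableSpace X] [MeasurableSpace Y]
  {μ : Measure X} {ν : Measure Y} [SFinite μ] [SFinite ν]

theorem ae_ae_slice {F G : X × Y → ℂ} (hFG : F =ᵐ[μ.prod ν] G) :
    ∀ᵐ y ∂ν, ∀ᵐ s ∂μ, F (s, y) = G (s, y) := by
  have h1 : ∀ᵐ w ∂(ν.prod μ), F w.swap = G w.swap :=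
    Measure.measurePreserving_swap.quasiMeasurePreserving.ae hFG
  exact Measure.ae_ae_of_ae_prod h1

theorem pio₁_apply {n : ℕ} {φ : Fin n → X → ℂ} {g : Fin n → Y → ℂ} (hφ : ∀ k, MemLp (φ k) 2 μ)
    (hg : ∀ k, MemLp (g k) ∞ ν) (f : Lp ℂ 2 (μ.prod ν)) :
    pio₁ μ ν (kernel₁ φ g) f =ᵐ[μ.prod ν]
      fun z => ∑ k, φ k z.1 * (g k z.2 * ∫ s, conj (φ k s) * f (s, z.2) ∂μ) := by
  obtain ⟨T, hT, hS⟩ := exists_pio₁_sum hφ hg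
  have e : pio₁ μ ν (kernel₁ φ g) f = ∑ k, T k f := by
    rw [← sum_apply]
    exact Lp.ext ((pio₁_spec hφ hg f).trans (hS f).symm)
  rw [e]
  filter_upwards [Lp.coeFn_fun_finsetSum Finset.univ (fun k => T k f),
    ae_all_iff.2 fun k => hT k f] with z h1 h2
  rw [h1]
  exact Finset.sum_congr rfl fun k _ => h2 k

theorem pio₂_apply {m : ℕ} {ψ : Fin m → Y → ℂ} {p : Fin m → X → ℂ} (hψ : ∀ j, MemLp (ψ j) 2 ν)
    (hp : ∀ j, MemLp (p j) ∞ μ) (f : Lp ℂ 2 (μ.prod ν)) :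
    pio₂ μ ν (kernel₂ ψ p) f =ᵐ[μ.prod ν]
      fun z => ∑ j, ψ j z.2 * (p j z.1 * ∫ t, conj (ψ j t) * f (z.1, t) ∂ν) := by
  obtain ⟨T, hT, hS⟩ := exists_pio₂_sum hψ hp
  have e : pio₂ μ ν (kernel₂ ψ p) f = ∑ k, T k f := by
    rw [← sum_apply]
    exact Lp.ext ((pio₂_spec hψ hp f).trans (hS f).symm)
  rw [e]
  filter_upwards [Lp.coeFn_fun_finsetSum Finset.univ (fun k => T k f),
    ae_all_iff.2 fun k => hT k f] with z h1 h2
  rw [h1]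
  exact Finset.sum_congr rfl fun k _ => h2 k

/-! ### Exchange of the variables -/

variable (μ ν) in
/-- The unitary `L²(ν × μ) → L²(μ × ν)` exchanging the two variables. -/
noncomputable def swapLp : Lp ℂ 2 (ν.prod μ) →L[ℂ] Lp ℂ 2 (μ.prod ν) :=
  (Lp.compMeasurePreservingₗᵢ ℂ Prod.swap
    Measure.measurePreserving_swap).toContinuousLinearMap

theorem swapLp_apply (f : Lp ℂ 2 (ν.prod μ)) : swapLp μ ν f =ᵐ[μ.prod ν] fun z => f z.swap :=
  Lp.coeFn_compMeasurePreserving f Measure.measurePreserving_swap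

theorem swapLp_swapLp (f : Lp ℂ 2 (μ.prod ν)) : swapLp μ ν (swapLp ν μ f) = f := by
  refine Lp.ext ?_
  filter_upwards [swapLp_apply (swapLp ν μ f),
    (Measure.measurePreserving_swap (μ := μ) (ν := ν)).quasiMeasurePreserving.ae
      (swapLp_apply (μ := ν) (ν := μ) f)] with z h1 h2
  rw [h1, h2, Prod.swap_swap]

/-- Results on `pio₁` carry over to `pio₂` through this identity. -/
theorem pio₂_eq_swap {m : ℕ} {ψ : Fin m → Y → ℂ} {p : Fin m → X → ℂ} (hψ : ∀ j, MemLp (ψ j) 2 ν)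
    (hp : ∀ j, MemLp (p j) ∞ μ) (f : Lp ℂ 2 (μ.prod ν)) :
    pio₂ μ ν (kernel₂ ψ p) f = swapLp μ ν (pio₁ ν μ (kernel₁ ψ p) (swapLp ν μ f)) := by
  have sw : MeasurePreserving Prod.swap (μ.prod ν) (ν.prod μ) := Measure.measurePreserving_swap
  have hV := Measure.quasiMeasurePreserving_fst (μ := μ) (ν := ν) |>.ae
    (ae_ae_slice (swapLp_apply (μ := ν) (ν := μ) f))
  refine Lp.ext ?_
  filter_upwards [pio₂_apply hψ hp f, swapLp_apply (pio₁ ν μ (kernel₁ ψ p) (swapLp ν μ f)),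
    sw.quasiMeasurePreserving.ae (pio₁_apply hψ hp (swapLp ν μ f)), hV] with z h1 h2 h3 h4
  rw [h1, h2, h3]
  refine Finset.sum_congr rfl fun j _ => ?_
  simp only [Prod.fst_swap, Prod.snd_swap]
  congr 2
  refine integral_congr_ae ?_
  filter_upwards [h4] with t ht
  rw [ht, Prod.swap_prod_mk]

/-- Conjugation by the exchange of variables, as a homomorphism of algebras. -/
noncomputable def swapConj : (Lp ℂ 2 (ν.prod μ) →L[ℂ] Lp ℂ 2 (ν.prod μ)) →ₐ[ℂ]
    (Lp ℂ 2 (μ.prod ν) →L[ℂ] Lp ℂ 2 (μ.prod ν)) :=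
  AlgHom.ofLinearMap
    { toFun := fun T => swapLp μ ν ∘L T ∘L swapLp ν μ
      map_add' := fun S T => by ext1 f; simp
      map_smul' := fun r T => by ext1 f; simp }
    (by ext1 f; exact swapLp_swapLp f)
    (fun S T => by ext1 f; simp [swapLp_swapLp])

theorem swapConj_apply (T : Lp ℂ 2 (ν.prod μ) →L[ℂ] Lp ℂ 2 (ν.prod μ)) (f : Lp ℂ 2 (μ.prod ν)) :
    swapConj T f = swapLp μ ν (T (swapLp ν μ f)) := rfl

theorem swapConj_swapConj (T : Lp ℂ 2 (ν.prod μ) →L[ℂ] Lp ℂ 2 (ν.prod μ)) :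
    swapConj (swapConj (μ := μ) (ν := ν) T) = T := by
  ext1 f
  simp [swapConj_apply, swapLp_swapLp]

theorem swapConj_pio₁ {m : ℕ} {ψ : Fin m → Y → ℂ} {p : Fin m → X → ℂ}
    (hψ : ∀ j, MemLp (ψ j) 2 ν) (hp : ∀ j, MemLp (p j) ∞ μ) :
    swapConj (pio₁ ν μ (kernel₁ ψ p)) = pio₂ μ ν (kernel₂ ψ p) := by
  ext1 f
  exact (pio₂_eq_swap hψ hp f).symm

theorem swapConj_pio₂ {m : ℕ} {ψ : Fin m → Y → ℂ} {p : Fin m → X → ℂ}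
    (hψ : ∀ j, MemLp (ψ j) 2 ν) (hp : ∀ j, MemLp (p j) ∞ μ) :
    swapConj (pio₂ μ ν (kernel₂ ψ p)) = pio₁ ν μ (kernel₁ ψ p) := by
  rw [← swapConj_pio₁ hψ hp, swapConj_swapConj]

/-! ### Symbol calculus and resolvents -/

/-- On each fibre the cross terms `∫ conj (φ k) * φ l` with `k ≠ l` vanish, so both operators are
diagonal in the same system. -/
theorem pio₁_mul_pio₁ {n : ℕ} {φ : Fin n → X → ℂ} {g g' : Fin n → Y → ℂ}
    (hφ : ∀ k, MemLp (φ k) 2 μ)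
    (ho : ∀ k l, ∫ s, conj (φ k s) * φ l s ∂μ = if k = l then 1 else 0)
    (hg : ∀ k, MemLp (g k) ∞ ν) (hg' : ∀ k, MemLp (g' k) ∞ ν) :
    pio₁ μ ν (kernel₁ φ g) * pio₁ μ ν (kernel₁ φ g') =
      pio₁ μ ν (kernel₁ φ fun k y => g k y * g' k y) := by
  have hgg : ∀ k, MemLp (fun y => g k y * g' k y) ∞ ν := fun k => (hg' k).mul (hg k)
  ext1 f
  refine Lp.ext ?_
  have hs := Measure.quasiMeasurePreserving_snd (μ := μ) (ν := ν) |>.ae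
    (ae_ae_slice (pio₁_apply hφ hg' f))
  filter_upwards [pio₁_apply hφ hg (pio₁ μ ν (kernel₁ φ g') f), pio₁_apply hφ hgg f, hs]
    with z h1 h2 h3
  rw [mul_apply_eq_comp, h1, h2]
  refine Finset.sum_congr rfl fun k _ => ?_
  rw [mul_assoc (g k z.2)]
  congr 2
  have e : ∫ s, conj (φ k s) * pio₁ μ ν (kernel₁ φ g') f (s, z.2) ∂μ =
      ∫ s, ∑ l, (conj (φ k s) * φ l s) * (g' l z.2 * ∫ s, conj (φ l s) * f (s, z.2) ∂μ) ∂μ := by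
    refine integral_congr_ae ?_
    filter_upwards [h3] with s hs
    rw [hs, Finset.mul_sum]
    exact Finset.sum_congr rfl fun l _ => (mul_assoc _ _ _).symm
  have hi : ∀ l, Integrable (fun s => conj (φ k s) * φ l s) μ := fun l =>
    MemLp.integrable_mul (p := 2) (q := 2) (hφ k).star (hφ l)
  rw [e, integral_finsetSum _ fun l _ => (hi l).mul_const _]
  simp only [integral_mul_const, ho, ite_mul, one_mul, zero_mul]
  simp

/-- Almost everywhere equality is what the resolvent symbols need: where `1 - τ g` vanishes, `g / (1
- τ g)` takes the default value `0` and the resolvent identity fails. -/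
theorem pio₁_congr {n : ℕ} {φ : Fin n → X → ℂ} {g g' : Fin n → Y → ℂ}
    (hφ : ∀ k, MemLp (φ k) 2 μ) (hg : ∀ k, MemLp (g k) ∞ ν) (he : ∀ k, g k =ᵐ[ν] g' k) :
    pio₁ μ ν (kernel₁ φ g) = pio₁ μ ν (kernel₁ φ g') := by
  have hg' : ∀ k, MemLp (g' k) ∞ ν := fun k => (hg k).ae_eq (he k)
  ext1 f
  refine Lp.ext ?_
  filter_upwards [pio₁_apply hφ hg f, pio₁_apply hφ hg' f,
    Measure.quasiMeasurePreserving_snd.ae (ae_all_iff.2 he)] with z h1 h2 h3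
  rw [h1, h2]
  simp only [h3]

theorem pio₁_sub {n : ℕ} {φ : Fin n → X → ℂ} {g g' : Fin n → Y → ℂ}
    (hφ : ∀ k, MemLp (φ k) 2 μ) (hg : ∀ k, MemLp (g k) ∞ ν) (hg' : ∀ k, MemLp (g' k) ∞ ν) :
    pio₁ μ ν (kernel₁ φ fun k y => g k y - g' k y) =
      pio₁ μ ν (kernel₁ φ g) - pio₁ μ ν (kernel₁ φ g') := by
  ext1 f
  refine Lp.ext ?_
  filter_upwards [pio₁_apply hφ hg f, pio₁_apply hφ hg' f,
    pio₁_apply hφ (g := fun k y => g k y - g' k y) (fun k => (hg k).sub (hg' k)) f,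
    Lp.coeFn_sub (pio₁ μ ν (kernel₁ φ g) f) (pio₁ μ ν (kernel₁ φ g') f)] with z h1 h2 h3 h4
  rw [sub_apply, h4, Pi.sub_apply, h1, h2, h3, ← Finset.sum_sub_distrib]
  exact Finset.sum_congr rfl fun k _ => by ring

theorem pio₁_smul {n : ℕ} {φ : Fin n → X → ℂ} {g : Fin n → Y → ℂ}
    (hφ : ∀ k, MemLp (φ k) 2 μ) (hg : ∀ k, MemLp (g k) ∞ ν) (c : ℂ) :
    pio₁ μ ν (kernel₁ φ fun k y => c * g k y) = c • pio₁ μ ν (kernel₁ φ g) := by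
  ext1 f
  refine Lp.ext ?_
  filter_upwards [pio₁_apply hφ hg f,
    pio₁_apply hφ (g := fun k y => c * g k y) (fun k => (hg k).const_mul c) f,
    Lp.coeFn_smul c (pio₁ μ ν (kernel₁ φ g) f)] with z h1 h2 h3
  rw [smul_apply, h3, Pi.smul_apply, h1, h2, smul_eq_mul, Finset.mul_sum]
  exact Finset.sum_congr rfl fun k _ => by ring

omit [SFinite ν] in
theorem memLp_resolvent_symbol {g : Y → ℂ} (hg : MemLp g ∞ ν) {τ : ℂ} {δ : ℝ} (hδ : 0 < δ)
    (hb : ∀ᵐ y ∂ν, δ ≤ ‖1 - τ * g y‖) : MemLp (fun y => g y / (1 - τ * g y)) ∞ ν := by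
  have h1 : MemLp (fun y => (1 - τ * g y)⁻¹) ∞ ν := by
    refine memLp_top_of_bound
      (((aestronglyMeasurable_const.sub (hg.1.const_mul τ)).aemeasurable.inv).aestronglyMeasurable)
      δ⁻¹ ?_
    filter_upwards [hb] with y hy
    rw [norm_inv]
    gcongr
  simp only [div_eq_mul_inv]
  exact h1.mul hg

/-- `(1 - τ T)⁻¹ = 1 + τ S` and `(1 - τ T) S = T`, where `S` has the symbols `g / (1 - τ g)`. -/
theorem isUnit_one_sub_smul_pio₁ {n : ℕ} {φ : Fin n → X → ℂ} {g : Fin n → Y → ℂ}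
    (hφ : ∀ k, MemLp (φ k) 2 μ)
    (ho : ∀ k l, ∫ s, conj (φ k s) * φ l s ∂μ = if k = l then 1 else 0)
    (hg : ∀ k, MemLp (g k) ∞ ν) {τ : ℂ}
    (hb : ∀ k, ∃ δ : ℝ, 0 < δ ∧ ∀ᵐ y ∂ν, δ ≤ ‖1 - τ * g k y‖) :
    (1 - τ • pio₁ μ ν (kernel₁ φ g)) * pio₁ μ ν (kernel₁ φ fun k y => g k y / (1 - τ * g k y)) =
        pio₁ μ ν (kernel₁ φ g) ∧
      IsUnit (1 - τ • pio₁ μ ν (kernel₁ φ g)) := by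
  set s : Fin n → Y → ℂ := fun k y => g k y / (1 - τ * g k y)
  have hs : ∀ k, MemLp (s k) ∞ ν := fun k => by
    obtain ⟨δ, h0, h1⟩ := hb k
    exact memLp_resolvent_symbol (hg k) h0 h1
  have hsg : ∀ k, MemLp (fun y => g k y * s k y) ∞ ν := fun k => (hs k).mul (hg k)
  have hτ : ∀ k, MemLp (fun y => τ * (g k y * s k y)) ∞ ν := fun k => (hsg k).const_mul τ
  have e1 : (1 - τ • pio₁ μ ν (kernel₁ φ g)) * pio₁ μ ν (kernel₁ φ s) =
      pio₁ μ ν (kernel₁ φ g) := by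
    rw [sub_mul, one_mul, smul_mul_assoc, pio₁_mul_pio₁ hφ ho hg hs, ← pio₁_smul hφ hsg,
      ← pio₁_sub hφ hs hτ]
    refine pio₁_congr hφ (fun k => (hs k).sub (hτ k)) fun k => ?_
    obtain ⟨δ, h0, h1⟩ := hb k
    filter_upwards [h1] with y hy
    have hne : 1 - τ * g k y ≠ 0 := norm_pos_iff.1 (h0.trans_le hy)
    simp only [s]
    field_simp
    rw [mul_comm (g k y) τ, mul_div_assoc, div_self hne, mul_one]
  -- Symbols commute pointwise, so the right inverse `1 + τ S` below is two-sided.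
  have hc : Commute (pio₁ μ ν (kernel₁ φ g)) (pio₁ μ ν (kernel₁ φ s)) := by
    rw [Commute, SemiconjBy, pio₁_mul_pio₁ hφ ho hg hs, pio₁_mul_pio₁ hφ ho hs hg]
    exact pio₁_congr hφ hsg fun k => .of_forall fun y => mul_comm _ _
  refine ⟨e1, ?_⟩
  have e2 : (1 - τ • pio₁ μ ν (kernel₁ φ g)) * (1 + τ • pio₁ μ ν (kernel₁ φ s)) = 1 := by
    rw [mul_add, mul_one, mul_smul_comm, e1]; abel
  have hc' : Commute (1 - τ • pio₁ μ ν (kernel₁ φ g)) (1 + τ • pio₁ μ ν (kernel₁ φ s)) :=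
    ((Commute.one_right _).add_right ((Commute.one_left _).sub_left
      ((hc.smul_left τ)) |>.smul_right τ))
  exact ⟨⟨_, _, e2, hc'.eq ▸ e2⟩, rfl⟩

theorem isUnit_one_sub_smul_pio₂ {m : ℕ} {ψ : Fin m → Y → ℂ} {p : Fin m → X → ℂ}
    (hψ : ∀ j, MemLp (ψ j) 2 ν)
    (ho : ∀ k l, ∫ s, conj (ψ k s) * ψ l s ∂ν = if k = l then 1 else 0)
    (hp : ∀ j, MemLp (p j) ∞ μ) {τ : ℂ}
    (hb : ∀ j, ∃ δ : ℝ, 0 < δ ∧ ∀ᵐ x ∂μ, δ ≤ ‖1 - τ * p j x‖) :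
    IsUnit (1 - τ • pio₂ μ ν (kernel₂ ψ p)) := by
  have := (isUnit_one_sub_smul_pio₁ (ν := μ) hψ ho hp hb).2.map (swapConj (μ := μ) (ν := ν))
  rwa [map_sub, map_one, map_smul, swapConj_pio₁ hψ hp] at this

/-! ### Product functions and Weyl sequences -/

theorem memLp_tensor {u : X → ℂ} (hu : MemLp u 2 μ) {w : Y → ℂ} (hw : MemLp w 2 ν) :
    MemLp (fun z : X × Y => u z.1 * w z.2) 2 (μ.prod ν) := by
  obtain ⟨h1, h2⟩ := tensor_norm (μ := μ) hu hw.1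
  exact ⟨h1, h2.trans_lt (ENNReal.mul_lt_top hu.2 hw.2)⟩

theorem tensor_ne_zero {u : X → ℂ} (hu : MemLp u 2 μ) {w : Y → ℂ} (hw : MemLp w 2 ν)
    (hu0 : ¬ u =ᵐ[μ] 0) (hw0 : ¬ w =ᵐ[ν] 0) : (memLp_tensor hu hw).toLp _ ≠ 0 := by
  intro h
  have h1 := congrArg (fun f => ‖f‖ₑ) h
  simp only [Lp.enorm_toLp, enorm_zero, (tensor_norm hu hw.1).2, mul_eq_zero] at h1
  rw [eLpNorm_eq_zero_iff hu.1 (by norm_num), eLpNorm_eq_zero_iff hw.1 (by norm_num)] at h1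
  exact h1.elim hu0 hw0

theorem pio₁_tensor {n : ℕ} {φ : Fin n → X → ℂ} {g : Fin n → Y → ℂ}
    (hφ : ∀ k, MemLp (φ k) 2 μ) (hg : ∀ k, MemLp (g k) ∞ ν)
    {u : X → ℂ} (hu : MemLp u 2 μ) {w : Y → ℂ} (hw : MemLp w 2 ν) :
    pio₁ μ ν (kernel₁ φ g) ((memLp_tensor hu hw).toLp _) =ᵐ[μ.prod ν] fun z =>
      ∑ k, φ k z.1 * (g k z.2 * ((∫ s, conj (φ k s) * u s ∂μ) * w z.2)) := by
  filter_upwards [pio₁_apply hφ hg ((memLp_tensor hu hw).toLp _),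
    Measure.quasiMeasurePreserving_snd.ae (ae_ae_slice (memLp_tensor hu hw).coeFn_toLp)]
    with z h1 h2
  rw [h1]
  refine Finset.sum_congr rfl fun k _ => ?_
  congr 2
  rw [← integral_mul_const]
  refine integral_congr_ae ?_
  filter_upwards [h2] with s hs
  rw [hs, mul_assoc]

theorem pio₂_tensor_eq_zero {m : ℕ} {ψ : Fin m → Y → ℂ} {p : Fin m → X → ℂ}
    (hψ : ∀ j, MemLp (ψ j) 2 ν) (hp : ∀ j, MemLp (p j) ∞ μ)
    {u : X → ℂ} (hu : MemLp u 2 μ) {w : Y → ℂ} (hw : MemLp w 2 ν)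
    (h0 : ∀ j, ∫ t, conj (ψ j t) * w t ∂ν = 0) :
    pio₂ μ ν (kernel₂ ψ p) ((memLp_tensor hu hw).toLp _) = 0 := by
  refine Lp.ext ?_
  filter_upwards [pio₂_apply hψ hp ((memLp_tensor hu hw).toLp _),
    Lp.coeFn_zero ℂ 2 (μ.prod ν),
    Measure.quasiMeasurePreserving_fst.ae
      (Measure.ae_ae_of_ae_prod (memLp_tensor hu hw).coeFn_toLp)] with z h1 h2 h3
  rw [h1, h2, Pi.zero_apply]
  refine Finset.sum_eq_zero fun j _ => ?_
  have : ∫ t, conj (ψ j t) * (memLp_tensor hu hw).toLp _ (z.1, t) ∂ν =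
      ∫ t, u z.1 * (conj (ψ j t) * w t) ∂ν := by
    refine integral_congr_ae ?_
    filter_upwards [h3] with t ht
    rw [ht]
    ring
  rw [this, integral_const_mul, h0, mul_zero, mul_zero, mul_zero]

/-- Weyl sequences `φᵢ ⊗ w` with `w` concentrated where `gᵢ` is near `l`. -/
theorem mem_spectrum_of_concentrated {n m : ℕ} {φ : Fin n → X → ℂ} {g : Fin n → Y → ℂ}
    {ψ : Fin m → Y → ℂ} {p : Fin m → X → ℂ} (hφ : ∀ k, MemLp (φ k) 2 μ)
    (ho : ∀ k l, ∫ s, conj (φ k s) * φ l s ∂μ = if k = l then 1 else 0)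
    (hg : ∀ k, MemLp (g k) ∞ ν) (hψ : ∀ j, MemLp (ψ j) 2 ν) (hp : ∀ j, MemLp (p j) ∞ μ)
    (i : Fin n) (l : ℂ)
    (hl : ∀ ε > 0, ∃ w : Y → ℂ, MemLp w 2 ν ∧ ¬ w =ᵐ[ν] 0 ∧
      (∀ j, ∫ t, conj (ψ j t) * w t ∂ν = 0) ∧ ∀ y, w y ≠ 0 → ‖g i y - l‖ ≤ ε) :
    l ∈ spectrum ℂ (pio₁ μ ν (kernel₁ φ g) + pio₂ μ ν (kernel₂ ψ p)) := by
  refine mem_spectrum_of_approx _ _ fun ε hε => ?_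
  obtain ⟨w, hw, hw0, hwψ, hwε⟩ := hl ε hε
  have hφ0 : ¬ φ i =ᵐ[μ] 0 := fun h => by
    have h1 := ho i i
    rw [integral_congr_ae (g := fun _ => (0 : ℂ))
      (by filter_upwards [h] with s hs; simp [hs])] at h1
    simp at h1
  refine ⟨_, tensor_ne_zero (hφ i) hw hφ0 hw0, ?_⟩
  rw [add_apply, pio₂_tensor_eq_zero hψ hp (hφ i) hw hwψ, add_zero]
  refine Lp.norm_le_mul_norm_of_ae_le_mul ?_
  set f := (memLp_tensor (hφ i) hw).toLp _
  filter_upwards [Lp.coeFn_sub (pio₁ μ ν (kernel₁ φ g) f) (l • f), Lp.coeFn_smul l f,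
    pio₁_tensor hφ hg (hφ i) hw, (memLp_tensor (hφ i) hw).coeFn_toLp] with z h1 h2 h3 h4
  -- Orthonormality leaves only `k = i`, so the error is `(g i - l)` times the trial function.
  have h5 : ∑ k, φ k z.1 * (g k z.2 * ((∫ s, conj (φ k s) * φ i s ∂μ) * w z.2)) =
      φ i z.1 * (g i z.2 * w z.2) := by
    simp only [ho, ite_mul, one_mul, zero_mul, mul_ite, mul_zero]
    simp
  rw [h1, Pi.sub_apply, h2, Pi.smul_apply, h3, h5, h4, smul_eq_mul]
  have h6 : φ i z.1 * (g i z.2 * w z.2) - l * (φ i z.1 * w z.2) =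
      (g i z.2 - l) * (φ i z.1 * w z.2) := by ring
  rw [h6, norm_mul]
  by_cases h : w z.2 = 0
  · simp [h]
  · gcongr
    exact hwε _ h

/-- Both operators annihilate `u ⊗ w`, so `0` is an eigenvalue. -/
theorem zero_mem_spectrum {n m : ℕ} {φ : Fin n → X → ℂ} {g : Fin n → Y → ℂ}
    {ψ : Fin m → Y → ℂ} {p : Fin m → X → ℂ} (hφ : ∀ k, MemLp (φ k) 2 μ)
    (hg : ∀ k, MemLp (g k) ∞ ν) (hψ : ∀ j, MemLp (ψ j) 2 ν) (hp : ∀ j, MemLp (p j) ∞ μ)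
    {u : X → ℂ} (hu : MemLp u 2 μ) (hu0 : ¬ u =ᵐ[μ] 0) (huφ : ∀ k, ∫ s, conj (φ k s) * u s ∂μ = 0)
    {w : Y → ℂ} (hw : MemLp w 2 ν) (hw0 : ¬ w =ᵐ[ν] 0)
    (hwψ : ∀ j, ∫ t, conj (ψ j t) * w t ∂ν = 0) :
    (0 : ℂ) ∈ spectrum ℂ (pio₁ μ ν (kernel₁ φ g) + pio₂ μ ν (kernel₂ ψ p)) := by
  refine mem_spectrum_of_approx _ _ fun ε hε => ⟨_, tensor_ne_zero hu hw hu0 hw0, ?_⟩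
  have h1 : pio₁ μ ν (kernel₁ φ g) ((memLp_tensor hu hw).toLp _) = 0 := by
    refine Lp.ext ?_
    filter_upwards [pio₁_tensor hφ hg hu hw, Lp.coeFn_zero ℂ 2 (μ.prod ν)] with z h1 h2
    rw [h1, h2]
    simp [huφ]
  rw [add_apply, h1, pio₂_tensor_eq_zero hψ hp hu hw hwψ, add_zero, zero_smul, sub_zero, norm_zero]
  positivity

/-! ### Essential ranges on an interval -/

/-- A set of positive measure in `[a, b]` carries a nonzero function orthogonal to finitely many
given ones, namely a polynomial multiple of its indicator. -/
theorem exists_orthogonal_supported {a b : ℝ} {m : ℕ} {ψ : Fin m → ℝ → ℂ}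
    (hψ : ∀ j, MemLp (ψ j) 2 (leb a b)) {A : Set ℝ} (hA : NullMeasurableSet A (leb a b))
    (hA0 : leb a b A ≠ 0) :
    ∃ w : ℝ → ℂ, MemLp w 2 (leb a b) ∧ ¬ w =ᵐ[leb a b] 0 ∧
      (∀ j, ∫ t, conj (ψ j t) * w t ∂(leb a b) = 0) ∧ ∀ y, w y ≠ 0 → y ∈ A := by
  let v : Polynomial ℂ → ℝ → ℂ := fun q => A.indicator fun t => q.eval (t : ℂ)
  have hc : ∀ q : Polynomial ℂ, Continuous fun t : ℝ => q.eval (t : ℂ) := fun q => by fun_prop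
  have hv : ∀ q, MemLp (v q) 2 (leb a b) := fun q => by
    obtain ⟨C, hC⟩ := isCompact_Icc.exists_bound_of_continuousOn (hc q).continuousOn (s := Icc a b)
    refine MemLp.of_bound ((hc q).aestronglyMeasurable.indicator₀ hA) C ?_
    filter_upwards [ae_restrict_mem measurableSet_Icc] with t ht
    exact (norm_indicator_le_norm_self _ _).trans (hC t ht)
  have hi : ∀ q j, Integrable (fun t => conj (ψ j t) * v q t) (leb a b) := fun q j =>
    MemLp.integrable_mul (p := 2) (q := 2) (hψ j).star (hv q)
  let L : Polynomial ℂ →ₗ[ℂ] Fin m → ℂ :=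
    { toFun := fun q j => ∫ t, conj (ψ j t) * v q t ∂(leb a b)
      map_add' := fun q r => by
        ext j
        rw [Pi.add_apply, ← integral_add (hi q j) (hi r j)]
        congr 1; ext t
        by_cases ht : t ∈ A <;> simp [v, ht, mul_add]
      map_smul' := fun c q => by
        ext j
        rw [RingHom.id_apply, Pi.smul_apply, ← integral_smul]
        congr 1; ext t
        by_cases ht : t ∈ A <;> simp [v, ht]
        ring }
  -- The polynomials are infinite-dimensional and the target is `ℂ^m`.
  have hL : ¬ Function.Injective L := fun h => Polynomial.not_finite (Module.Finite.of_injective L h)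
  rw [injective_iff_map_eq_zero] at hL
  push Not at hL
  obtain ⟨q, hq, hq0⟩ := hL
  refine ⟨v q, hv q, fun h => hA0 ?_, fun j => congrFun hq j, fun y hy => mem_of_indicator_ne_zero hy⟩
  -- A nonzero polynomial has a null zero set, so its restriction to `A` vanishes almost everywhere
  -- only if `A` is null.
  have hfin : ({t : ℝ | q.eval (t : ℂ) = 0}).Finite := by
    refine Set.Finite.preimage (f := ((↑) : ℝ → ℂ)) Complex.ofReal_injective.injOn
      (Polynomial.finite_setOfPred_isRoot hq0)
  have h2 : ∀ᵐ t : ℝ ∂(leb a b), q.eval (t : ℂ) ≠ 0 := by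
    simpa only [ae_iff, not_not] using hfin.measure_zero (leb a b)
  have h3 : ∀ᵐ t ∂(leb a b), t ∉ A := by
    filter_upwards [h, h2] with t h4 h5 h6
    simp only [v, indicator_of_mem h6, Pi.zero_apply] at h4
    exact h5 h4
  exact measure_eq_zero_iff_ae_notMem.2 h3

theorem exists_concentrated_of_mem_essran {a b : ℝ} {m : ℕ} {ψ : Fin m → ℝ → ℂ}
    (hψ : ∀ j, MemLp (ψ j) 2 (leb a b)) {g : ℝ → ℝ} (hg : MemLp g ∞ (leb a b)) {l : ℝ}
    (hl : l ∈ Essran (Icc a b) g) {ε : ℝ} (hε : 0 < ε) :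
    ∃ w : ℝ → ℂ, MemLp w 2 (leb a b) ∧ ¬ w =ᵐ[leb a b] 0 ∧
      (∀ j, ∫ t, conj (ψ j t) * w t ∂(leb a b) = 0) ∧ ∀ y, w y ≠ 0 → ‖(g y : ℂ) - l‖ ≤ ε := by
  have hA : NullMeasurableSet (g ⁻¹' Ioo (l - ε) (l + ε)) (leb a b) :=
    hg.1.aemeasurable.nullMeasurable measurableSet_Ioo
  have hA0 : leb a b (g ⁻¹' Ioo (l - ε) (l + ε)) ≠ 0 := by
    rw [Measure.restrict_apply' measurableSet_Icc, inter_comm]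
    exact (hl ε hε).ne'
  obtain ⟨w, h1, h2, h3, h4⟩ := exists_orthogonal_supported hψ hA hA0
  refine ⟨w, h1, h2, h3, fun y hy => ?_⟩
  obtain ⟨h5, h6⟩ := h4 y hy
  rw [← Complex.ofReal_sub, Complex.norm_real, Real.norm_eq_abs, abs_le]
  constructor <;> linarith

/-- Factoring out `l⁻¹` leaves a lower bound for `‖l - g‖`. For real `l` the `ε` violating the
definition of `Essran` serves; otherwise `|l.im|` does, since `g` is real. -/
theorem exists_bound_of_notMem_essran {a b : ℝ} {g : ℝ → ℝ} {l : ℂ} (hl0 : l ≠ 0)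
    (hl : l ∉ Complex.ofReal '' Essran (Icc a b) g) :
    ∃ δ : ℝ, 0 < δ ∧ ∀ᵐ y ∂(leb a b), δ ≤ ‖1 - l⁻¹ * (g y : ℂ)‖ := by
  suffices h : ∃ δ : ℝ, 0 < δ ∧ ∀ᵐ y ∂(leb a b), δ ≤ ‖l - (g y : ℂ)‖ by
    obtain ⟨δ, h0, h1⟩ := h
    refine ⟨‖l⁻¹‖ * δ, mul_pos (norm_pos_iff.2 (inv_ne_zero hl0)) h0, ?_⟩
    filter_upwards [h1] with y hy
    have : 1 - l⁻¹ * (g y : ℂ) = l⁻¹ * (l - g y) := by rw [mul_sub, inv_mul_cancel₀ hl0]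
    rw [this, norm_mul]
    gcongr
  by_cases him : l.im = 0
  · have hlr : ((l.re : ℝ) : ℂ) = l := Complex.ext rfl (by simp [him])
    have h1 : l.re ∉ Essran (Icc a b) g := fun h => hl ⟨_, h, hlr⟩
    simp only [Essran, mem_ofPred_eq, not_forall, not_lt, nonpos_iff_eq_zero] at h1
    obtain ⟨ε, hε, h2⟩ := h1
    refine ⟨ε, hε, ?_⟩
    rw [ae_restrict_iff' measurableSet_Icc, ae_iff]
    refine measure_mono_null (fun y hy => ?_) h2
    simp only [mem_ofPred_eq, Classical.not_imp, not_le] at hy ⊢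
    rw [← hlr, ← Complex.ofReal_sub, Complex.norm_real, Real.norm_eq_abs, abs_lt] at hy
    exact ⟨hy.1, by linarith [hy.2.2], by linarith [hy.2.1]⟩
  · refine ⟨|l.im|, abs_pos.2 him, .of_forall fun y => ?_⟩
    simpa using Complex.abs_im_le_norm (l - (g y : ℂ))

omit [SFinite μ] in
theorem integral_conj_mul_of_orthonormal {n : ℕ} {φ : Fin n → Lp ℂ 2 μ} (hφ : Orthonormal ℂ φ)
    (k l : Fin n) : ∫ s, conj (φ k s) * φ l s ∂μ = if k = l then 1 else 0 := by
  rw [← orthonormal_iff_ite.1 hφ k l, L2.inner_def]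
  simp only [RCLike.inner_apply, mul_comm]

/-! ### The spectrum of the sum -/

section interval

variable {a b c d : ℝ} {n m : ℕ}
  {φ : Fin n → Lp ℂ 2 (leb a b)} {h : Fin n → ℝ → ℝ}
  {ψ : Fin m → Lp ℂ 2 (leb c d)} {p : Fin m → ℝ → ℝ}

theorem essran_left_subset_spectrum (hφ : Orthonormal ℂ φ) (hh : ∀ i, MemLp (h i) ∞ (leb c d))
    (hp : ∀ j, MemLp (p j) ∞ (leb a b)) (i : Fin n) :
    Complex.ofReal '' Essran (Icc c d) (h i) ⊆ spectrum ℂ (T₁ φ h c d + T₂ ψ p a b) := by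
  rintro _ ⟨l, hl, rfl⟩
  exact mem_spectrum_of_concentrated (fun k => Lp.memLp _) (integral_conj_mul_of_orthonormal hφ)
    (fun k => (hh k).ofReal) (fun j => Lp.memLp _) (fun j => (hp j).ofReal) i l
    fun ε hε => exists_concentrated_of_mem_essran (fun j => Lp.memLp _) (hh i) hl hε

theorem essran_right_subset_spectrum (hψ : Orthonormal ℂ ψ) (hh : ∀ i, MemLp (h i) ∞ (leb c d))
    (hp : ∀ j, MemLp (p j) ∞ (leb a b)) (j : Fin m) :
    Complex.ofReal '' Essran (Icc a b) (p j) ⊆ spectrum ℂ (T₁ φ h c d + T₂ ψ p a b) := by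
  have e : swapConj (T₁ ψ p a b + T₂ φ h c d) = T₁ φ h c d + T₂ ψ p a b := by
    rw [map_add, add_comm]
    exact congrArg₂ (· + ·)
      (swapConj_pio₂ (fun k => Lp.memLp _) fun k => (hh k).ofReal)
      (swapConj_pio₁ (fun j => Lp.memLp _) fun j => (hp j).ofReal)
  have e' : swapConj (T₁ φ h c d + T₂ ψ p a b) = T₁ ψ p a b + T₂ φ h c d := by
    rw [← e, swapConj_swapConj]
  -- After the exchange `p` is a symbol of the first kind; an algebra homomorphism cannot enlarge
  -- spectra.
  refine (essran_left_subset_spectrum (ψ := φ) hψ hp hh j).trans ?_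
  rw [← e']
  exact AlgHom.spectrum_apply_subset _ _

/-- Nondegeneracy of both intervals enters here: on an interval of positive length some nonzero
function is orthogonal to the given finite system. -/
theorem zero_mem_spectrum_T₁_add_T₂ (hab : a < b) (hcd : c < d)
    (hh : ∀ i, MemLp (h i) ∞ (leb c d)) (hp : ∀ j, MemLp (p j) ∞ (leb a b)) :
    (0 : ℂ) ∈ spectrum ℂ (T₁ φ h c d + T₂ ψ p a b) := by
  have hpos : ∀ {a b : ℝ}, a < b → leb a b univ ≠ 0 := fun hab => by simpa using hab
  obtain ⟨u, hu, hu0, huφ, -⟩ := exists_orthogonal_supported (fun k => Lp.memLp (φ k))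
    MeasurableSet.univ.nullMeasurableSet (hpos hab)
  obtain ⟨w, hw, hw0, hwψ, -⟩ := exists_orthogonal_supported (fun k => Lp.memLp (ψ k))
    MeasurableSet.univ.nullMeasurableSet (hpos hcd)
  exact zero_mem_spectrum (fun k => Lp.memLp _) (fun k => (hh k).ofReal)
    (fun j => Lp.memLp _) (fun j => (hp j).ofReal) hu hu0 huφ hw hw0 hwψ

/-- Away from `0` and the essential ranges of the symbols the spectrum is given by the zeros of
the determinant. -/
theorem mem_spectrum_iff_mem_setD₀ (hφ : Orthonormal ℂ φ) (hψ : Orthonormal ℂ ψ)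
    (hh : ∀ i, MemLp (h i) ∞ (leb c d)) (hp : ∀ j, MemLp (p j) ∞ (leb a b))
    {l : ℂ} (hl : l ≠ 0) (hlh : ∀ i, l ∉ Complex.ofReal '' Essran (Icc c d) (h i))
    (hlp : ∀ j, l ∉ Complex.ofReal '' Essran (Icc a b) (p j)) :
    l ∈ spectrum ℂ (T₁ φ h c d + T₂ ψ p a b) ↔ l ∈ setD₀ φ h ψ p := by
  have hτ : l⁻¹ ≠ 0 := inv_ne_zero hl
  have hbh := fun i => exists_bound_of_notMem_essran hl (hlh i)
  have hbp := fun j => exists_bound_of_notMem_essran hl (hlp j)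
  obtain ⟨hS, hU₁⟩ : (1 - l⁻¹ • T₁ φ h c d) * S₁ φ h c d l⁻¹ = T₁ φ h c d ∧
      IsUnit (1 - l⁻¹ • T₁ φ h c d) :=
    isUnit_one_sub_smul_pio₁ (fun k => Lp.memLp _) (integral_conj_mul_of_orthonormal hφ)
      (fun k => (hh k).ofReal) hbh
  have hU₂ : IsUnit (1 - l⁻¹ • T₂ ψ p a b) :=
    isUnit_one_sub_smul_pio₂ (fun k => Lp.memLp _) (integral_conj_mul_of_orthonormal hψ)
      (fun k => (hp k).ofReal) hbp
  have hfin : FiniteDimensional ℂ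
      (LinearMap.range (S₁ φ h c d l⁻¹ ∘L T₂ ψ p a b).toLinearMap) :=
    finiteDimensional_range_pio₁_comp_pio₂ (fun k => Lp.memLp _)
      (fun k => by
        obtain ⟨δ, h0, h1⟩ := hbh k
        exact memLp_resolvent_symbol (hh k).ofReal h0 h1)
      (fun k => Lp.memLp _) (fun k => (hp k).ofReal)
  have hfinW : FiniteDimensional ℂ
      (LinearMap.range (l⁻¹ ^ 2 • W₁ φ h ψ p l⁻¹).toLinearMap) := by
    -- A linear image of the finite-dimensional range of `S₁ T₂` is finite-dimensional.
    have e : (l⁻¹ ^ 2 • W₁ φ h ψ p l⁻¹).toLinearMap =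
        (l⁻¹ ^ 2 • Ring.inverse (1 - l⁻¹ • T₂ ψ p a b)).toLinearMap ∘ₗ
          (S₁ φ h c d l⁻¹ ∘L T₂ ψ p a b).toLinearMap := by
      ext1 f
      simp [W₁]
    rw [e, LinearMap.range_comp]
    infer_instance
  -- The determinant detects algebraic bijectivity; on a Banach space this already gives a bounded
  -- inverse.
  have hΔ : Δ₁ φ h ψ p l⁻¹ ≠ 0 ↔ IsUnit (1 - l⁻¹ ^ 2 • W₁ φ h ψ p l⁻¹) := by
    rw [Δ₁, fredholmDet_ne_zero_iff, ContinuousLinearMap.isUnit_iff_bijective]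
    rfl
  have hT : l ∉ spectrum ℂ (T₁ φ h c d + T₂ ψ p a b) ↔ Δ₁ φ h ψ p l⁻¹ ≠ 0 := by
    rw [hΔ, spectrum, notMem_compl_iff, ← inv_inv l, ← isUnit_one_sub_smul_iff _ hτ, inv_inv,
      one_sub_smul_add_eq hS hU₂]
    exact (hU₁.mul hU₂).mul_left_iff
  rw [← not_iff_not, hT]
  constructor
  · rintro h0 ⟨τ, ⟨-, -, h1⟩, rfl⟩
    exact h0 (by simpa using h1)
  · intro h0 h1
    refine h0 ⟨l⁻¹, ⟨hτ, ⟨?_, ?_⟩, h1⟩, by simp⟩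
    -- The resolvent conditions in `setD` hold automatically off the essential ranges.
    · exact (isUnit_one_sub_smul_iff _ hτ).1 hU₁
    · exact (isUnit_one_sub_smul_iff _ hτ).1 hU₂

end interval

end PartialIntegral

theorem theorem4p6 {a b c d : ℝ} (hab : a < b) (hcd : c < d) {n m : ℕ}
    (φ : Fin n → Lp ℂ 2 (PartialIntegral.leb a b)) (hφ : Orthonormal ℂ φ)
    (h : Fin n → ℝ → ℝ) (hh : ∀ i, MemLp (h i) ∞ (PartialIntegral.leb c d))
    (ψ : Fin m → Lp ℂ 2 (PartialIntegral.leb c d)) (hψ : Orthonormal ℂ ψ)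
    (p : Fin m → ℝ → ℝ) (hp : ∀ j, MemLp (p j) ∞ (PartialIntegral.leb a b)) :
    spectrum ℂ (PartialIntegral.T₁ φ h c d + PartialIntegral.T₂ ψ p a b) =
      {0} ∪ (⋃ i, Complex.ofReal '' PartialIntegral.Essran (Icc c d) (h i))
        ∪ (⋃ j, Complex.ofReal '' PartialIntegral.Essran (Icc a b) (p j))
        ∪ PartialIntegral.setD₀ φ h ψ p := by
  ext l
  simp only [mem_union, mem_singleton_iff, mem_iUnion]
  by_cases hl : l = 0
  · subst hl
    simpa using PartialIntegral.zero_mem_spectrum_T₁_add_T₂ hab hcd hh hp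
  -- Points of the essential ranges lie in both sides whether or not they are in `setD₀`, which
  -- therefore matters only away from them.
  by_cases hlh : ∃ i, l ∈ Complex.ofReal '' PartialIntegral.Essran (Icc c d) (h i)
  · obtain ⟨i, hi⟩ := hlh
    exact iff_of_true (PartialIntegral.essran_left_subset_spectrum hφ hh hp i hi)
      (.inl (.inl (.inr ⟨i, hi⟩)))
  by_cases hlp : ∃ j, l ∈ Complex.ofReal '' PartialIntegral.Essran (Icc a b) (p j)
  · obtain ⟨j, hj⟩ := hlp
    exact iff_of_true (PartialIntegral.essran_right_subset_spectrum hψ hh hp j hj)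
      (.inl (.inr ⟨j, hj⟩))
  rw [PartialIntegral.mem_spectrum_iff_mem_setD₀ hφ hψ hh hp hl (not_exists.1 hlh)
    (not_exists.1 hlp)]
  simp only [hl, hlh, hlp, false_or]
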